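/- For positive integers $n$, write $[n]=\{1,\dots,n\}$. For $p\in(0,1)$ and a family $\mathcal A$ of subsets of $[n]$ let $\mu_p(\mathcal A)=\sum_{A\in\mathcal A}p^{|A|}(1-p)^{n-|A|}$, and let $\mathcal F^t_r=\{F\subseteq[n]:|F\cap[t+2r]|\ge t+r\}$. A family $\mathcal A$ is shifted if $A\in\mathcal A$, $i<j$ and $A\cap\{i,j\}=\{j\}$ imply $(A\setminus\{j\})\cup\{i\}\in\mathcal A$; it is inclusion maximal if $A\in\mathcal A$ and $A\subseteq A'\subseteq[n]$ imply $A'\in\mathcal A$. Two families $\mathcal A,\mathcal B$ of subsets of $[n]$ are $t$-nice if both are shifted and inclusion maximal and $|A\cap B|\ge t$ for all $A\in\mathcal A$, $B\in\mathcal B$. Theorem. For every integer $r\ge 0$ and all real numbers $\epsilon\in(0,1/2)$, $C>2$ and $\delta_0\in(0,\epsilon/(r+1))$ there is an integer $t_0=t_0(r,\epsilon,C,\delta_0)$ such that for all integers $t\ge t_0$ and $n\ge t+2r$ the following holds. Let $\frac{r+\epsilon}{t}\le p\le\frac{r+1-\epsilon}{t}$, let $\mathcal A,\mathcal B\subseteq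 2^{[n]}$ be $t$-nice families, and let $\delta\in(0,\delta_0]$. If $$\mu_p(\mathcal A)\,\mu_p(\mathcal B)\ge(1-\delta)\,\mu_p(\mathcal F^t_r)^2,$$ then $$\mu_p(\mathcal A\triangle\mathcal F^t_r)+\mu_p(\mathcal B\triangle\mathcal F^t_r)\le C\left(1-\sqrt{1-\delta}\right)\mu_p(\mathcal F^t_r).$$ -/

import Mathlib

open scoped symmDiff

namespace CrossIntersecting

/-- The product measure `μ_p(𝒜) = ∑_{A ∈ 𝒜} p^|A| (1-p)^(n-|A|)` of a family of subsets of an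
`n`-element ground set. The ground set `[n] = {1, …, n}` is modelled by `Fin n`, the element `i + 1`
of `[n]` being `i : Fin n`. -/
noncomputable def productMeasure {n : ℕ} (p : ℝ) (𝒜 : Finset (Finset (Fin n))) : ℝ :=
  ∑ A ∈ 𝒜, p ^ A.card * (1 - p) ^ (n - A.card)

/-- `F ∩ [m]`, the part of `F` among the first `m` elements of the ground set. -/
def initialPart {n : ℕ} (m : ℕ) (F : Finset (Fin n)) : Finset (Fin n) :=
  F.filter (fun i => (i : ℕ) < m)

/-- The family `ℱ^t_r = {F ⊆ [n] : |F ∩ [t + 2r]| ≥ t + r}`. -/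
def franklFamily (n t r : ℕ) : Finset (Finset (Fin n)) :=
  Finset.univ.filter (fun F => t + r ≤ (initialPart (t + 2 * r) F).card)

/-- `𝒜` is shifted: if `i < j` and `{i, j} ∩ A = {j}` for some `A ∈ 𝒜`, then
`(A \ {j}) ∪ {i} ∈ 𝒜`. -/
def IsShifted {n : ℕ} (𝒜 : Finset (Finset (Fin n))) : Prop :=
  ∀ A ∈ 𝒜, ∀ i j : Fin n, i < j → i ∉ A → j ∈ A → insert i (A.erase j) ∈ 𝒜

/-- `𝒜` is inclusion maximal, in the sense of being closed under taking supersets. -/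
def IsInclusionMaximal {n : ℕ} (𝒜 : Finset (Finset (Fin n))) : Prop :=
  ∀ A ∈ 𝒜, ∀ A' : Finset (Fin n), A ⊆ A' → A' ∈ 𝒜

/-- `𝒜` and `ℬ` are cross `t`-intersecting. -/
def IsCrossIntersecting {n : ℕ} (t : ℕ) (𝒜 ℬ : Finset (Finset (Fin n))) : Prop :=
  ∀ A ∈ 𝒜, ∀ B ∈ ℬ, t ≤ (A ∩ B).card

/-- `𝒜` and `ℬ` are `t`-nice: both are shifted and inclusion maximal, and they are cross
`t`-intersecting. -/
structure IsNice {n : ℕ} (t : ℕ) (𝒜 ℬ : Finset (Finset (Fin n))) : Prop where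
  shifted_left : IsShifted 𝒜
  shifted_right : IsShifted ℬ
  maximal_left : IsInclusionMaximal 𝒜
  maximal_right : IsInclusionMaximal ℬ
  cross : IsCrossIntersecting t 𝒜 ℬ

end CrossIntersecting

/-! Read a set as a walk: an element is a step up, a non-element a step to the right, and `height`
is ups minus rights. For shifted cross t-intersecting families, any two walks have heights summing
to at least 2t at a common time (`IsCrossIntersecting.exists_height_add_height`), so the least
maximal heights u, v of the two families satisfy u + v ≥ 2t. A walk reaches height u with
probability at most α^u, where α = p/(1-p), and does so at two times with probability at most
2p·α^u. As p is of order 1/t, contributions of order p·α^(2t) are negligible. Hence a nearly optimal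
product forces u + v = 2t, and both families contain walks with a unique peak, all such peaks at one
time t+i+j (`IsNice.product_small_or_peak`).

Up to negligible terms the product is then at most p^(2t)·(x^i/i!)·(x^j/j!) with x = pt, while ℱ^t_r
has measure about p^t·x^r/r!. For r+ε ≤ x ≤ r+1-ε any other index loses a factor 1 - ε/(r+1). This
is where δ₀ < ε/(r+1) enters, and it gives i = j = r (`IsNice.exists_peaksOnlyAt_of_product_ge`).

Now bootstrap. Once ℬ has a walk peaking only at time t+2r with height t, a member of 𝒜 outside
ℱ^t_r must climb above t, and its presence expels from ℬ a far larger part of ℱ^t_r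
(`IsNice.sdiff_franklFamily`). So μ(𝒜 \ ℱ) ≤ η·μ(ℱ \ ℬ) for any fixed η > 0 once t is large, and
symmetrically. The AM-GM inequality converts this into the claim (`add_le_of_product_ge`); the
constant tends to 2 as η tends to 0. -/

namespace CrossIntersecting

/-! ### Sets as lattice walks. -/

/-- The measure of the family of all sets satisfying `Q`. -/
noncomputable def prob (p : ℝ) (n : ℕ) (Q : Finset (Fin n) → Prop) : ℝ :=
  open scoped Classical in productMeasure p (Finset.univ.filter Q)

/-- Prepend a step to the walk of a set: shift `A` by one and adjoin the first element if `b`. -/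
def consStep {n : ℕ} (b : Bool) (A : Finset (Fin n)) : Finset (Fin (n + 1)) :=
  if b then insert 0 (A.map (Fin.succEmb n)) else A.map (Fin.succEmb n)

/-- The height `2|A ∩ [k]| - k` of the walk of `A` after `k` steps. -/
def height {n : ℕ} (A : Finset (Fin n)) (k : ℕ) : ℤ :=
  2 * ((initialPart k A).card : ℤ) - k

theorem initialPart_zero {n : ℕ} (A : Finset (Fin n)) : initialPart 0 A = ∅ := by
  simp [initialPart]

theorem card_consStep_true {n : ℕ} (A : Finset (Fin n)) :
    (consStep true A).card = A.card + 1 := by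
  simp [consStep]

theorem card_consStep_false {n : ℕ} (A : Finset (Fin n)) :
    (consStep false A).card = A.card := by
  simp [consStep]

theorem initialPart_consStep_true {n : ℕ} (A : Finset (Fin n)) (k : ℕ) :
    initialPart (k + 1) (consStep true A) = consStep true (initialPart k A) := by
  ext i
  refine Fin.cases ?_ (fun j => ?_) i <;> simp [initialPart, consStep]

theorem initialPart_consStep_false {n : ℕ} (A : Finset (Fin n)) (k : ℕ) :
    initialPart (k + 1) (consStep false A) = consStep false (initialPart k A) := by
  ext i
  refine Fin.cases ?_ (fun j => ?_) i <;> simp [initialPart, consStep]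

theorem height_zero {n : ℕ} (A : Finset (Fin n)) : height A 0 = 0 := by
  simp [height, initialPart_zero]

theorem height_consStep_true {n : ℕ} (A : Finset (Fin n)) (k : ℕ) :
    height (consStep true A) (k + 1) = height A k + 1 := by
  simp only [height, initialPart_consStep_true, card_consStep_true]
  push_cast; ring

theorem height_consStep_false {n : ℕ} (A : Finset (Fin n)) (k : ℕ) :
    height (consStep false A) (k + 1) = height A k - 1 := by
  simp only [height, initialPart_consStep_false, card_consStep_false]
  push_cast; ring

/-- Beyond the ground set every step counts as a step to the right, so times need no upper bound. -/
theorem height_of_fin_zero (A : Finset (Fin 0)) (k : ℕ) : height A k = -k := by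
  have : A = ∅ := Subsingleton.elim _ _
  subst this
  simp [height, initialPart]

theorem card_initialPart_mono {n : ℕ} (A : Finset (Fin n)) {k l : ℕ} (h : k ≤ l) :
    (initialPart k A).card ≤ (initialPart l A).card :=
  Finset.card_le_card fun i hi => by
    simp only [initialPart, Finset.mem_filter] at hi ⊢
    exact ⟨hi.1, hi.2.trans_le h⟩

theorem card_initialPart_add_le {n : ℕ} (A : Finset (Fin n)) (k l : ℕ) :
    (initialPart (k + l) A).card ≤ (initialPart k A).card + l := by
  induction l with
  | zero => simp
  | succ l ih =>
    refine le_trans ?_ (Nat.succ_le_succ ih)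
    by_cases h : k + l < n
    · refine (Finset.card_le_card (t := insert ⟨k + l, h⟩ (initialPart (k + l) A)) ?_).trans
        (Finset.card_insert_le _ _)
      intro i hi
      simp only [initialPart, Finset.mem_filter, Finset.mem_insert, Fin.ext_iff] at hi ⊢
      by_cases h' : (i : ℕ) = k + l
      · exact Or.inl h'
      · exact Or.inr ⟨hi.1, by omega⟩
    · refine (Finset.card_le_card fun i hi => ?_).trans (Nat.le_succ _)
      simp only [initialPart, Finset.mem_filter] at hi ⊢
      exact ⟨hi.1, by omega⟩

theorem height_add_le {n : ℕ} (A : Finset (Fin n)) (k l : ℕ) :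
    height A (k + l) ≤ height A k + l := by
  have := card_initialPart_add_le A k l
  simp only [height]; push_cast; omega

theorem height_sub_le {n : ℕ} (A : Finset (Fin n)) (k l : ℕ) :
    height A k - l ≤ height A (k + l) := by
  have := card_initialPart_mono A (Nat.le_add_right k l)
  simp only [height]; push_cast; omega

theorem height_le {n : ℕ} (A : Finset (Fin n)) (k : ℕ) : height A k ≤ k := by
  simpa [height_zero] using height_add_le A 0 k

/-- 2(t + r) - (t + 2r) = t. -/
theorem mem_franklFamily {n t r : ℕ} {A : Finset (Fin n)} :
    A ∈ franklFamily n t r ↔ (t : ℤ) ≤ height A (t + 2 * r) := by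
  simp only [franklFamily, height, Finset.mem_filter, Finset.mem_univ, true_and]
  omega

/-! ### The product measure as a probability. -/

section Measure

variable {n : ℕ} {p : ℝ}

theorem productMeasure_mono (h0 : 0 ≤ p) (h1 : p ≤ 1) {𝒜 ℬ : Finset (Finset (Fin n))}
    (h : 𝒜 ⊆ ℬ) : productMeasure p 𝒜 ≤ productMeasure p ℬ :=
  Finset.sum_le_sum_of_subset_of_nonneg h fun A _ _ =>
    mul_nonneg (pow_nonneg h0 _) (pow_nonneg (by linarith) _)

theorem productMeasure_nonneg (h0 : 0 ≤ p) (h1 : p ≤ 1) (𝒜 : Finset (Finset (Fin n))) :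
    0 ≤ productMeasure p 𝒜 :=
  Finset.sum_nonneg fun A _ => mul_nonneg (pow_nonneg h0 _) (pow_nonneg (by linarith) _)

theorem productMeasure_sdiff_add_inter (𝒜 ℬ : Finset (Finset (Fin n))) :
    productMeasure p (𝒜 \ ℬ) + productMeasure p (𝒜 ∩ ℬ) = productMeasure p 𝒜 := by
  unfold productMeasure
  rw [add_comm]
  exact Finset.sum_inter_add_sum_sdiff 𝒜 ℬ _

theorem productMeasure_symmDiff (𝒜 ℬ : Finset (Finset (Fin n))) :
    productMeasure p (𝒜 ∆ ℬ) = productMeasure p (𝒜 \ ℬ) + productMeasure p (ℬ \ 𝒜) :=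
  Finset.sum_union disjoint_sdiff_sdiff

theorem productMeasure_union_le (h0 : 0 ≤ p) (h1 : p ≤ 1) (𝒜 ℬ : Finset (Finset (Fin n))) :
    productMeasure p (𝒜 ∪ ℬ) ≤ productMeasure p 𝒜 + productMeasure p ℬ := by
  have h := Finset.sum_union_inter (s₁ := 𝒜) (s₂ := ℬ)
    (f := fun A : Finset (Fin n) => p ^ A.card * (1 - p) ^ (n - A.card))
  have := productMeasure_nonneg h0 h1 (𝒜 ∩ ℬ)
  unfold productMeasure at *
  linarith

theorem productMeasure_le_prob (h0 : 0 ≤ p) (h1 : p ≤ 1) {𝒜 : Finset (Finset (Fin n))}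
    {Q : Finset (Fin n) → Prop} (h : ∀ A ∈ 𝒜, Q A) : productMeasure p 𝒜 ≤ prob p n Q :=
  productMeasure_mono h0 h1 fun A hA => by simpa using h A hA

theorem prob_le_productMeasure (h0 : 0 ≤ p) (h1 : p ≤ 1) {𝒜 : Finset (Finset (Fin n))}
    {Q : Finset (Fin n) → Prop} (h : ∀ A, Q A → A ∈ 𝒜) : prob p n Q ≤ productMeasure p 𝒜 :=
  productMeasure_mono h0 h1 fun A hA => h A (by simpa using hA)

theorem prob_mono (h0 : 0 ≤ p) (h1 : p ≤ 1) {Q R : Finset (Fin n) → Prop}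
    (h : ∀ A, Q A → R A) : prob p n Q ≤ prob p n R :=
  productMeasure_le_prob h0 h1 fun A hA => h A (by simpa using hA)

theorem prob_nonneg (h0 : 0 ≤ p) (h1 : p ≤ 1) (Q : Finset (Fin n) → Prop) : 0 ≤ prob p n Q :=
  productMeasure_nonneg h0 h1 _

theorem prob_or_le (h0 : 0 ≤ p) (h1 : p ≤ 1) (Q R : Finset (Fin n) → Prop) :
    prob p n (fun A => Q A ∨ R A) ≤ prob p n Q + prob p n R := by
  classical
  refine le_trans ?_ (productMeasure_union_le h0 h1 _ _)
  exact prob_le_productMeasure h0 h1 fun A hA => by simpa using hA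

theorem prob_not (Q : Finset (Fin n) → Prop) :
    prob p n (fun A => ¬ Q A) + prob p n Q = prob p n fun _ => True := by
  classical
  unfold prob productMeasure
  rw [add_comm, Finset.filter_true]
  convert Finset.sum_filter_add_sum_filter_not _ _ _

theorem prob_false : prob p n (fun _ => False) = 0 := by
  simp [prob, productMeasure]

theorem prob_congr {Q R : Finset (Fin n) → Prop} (h : ∀ A, Q A ↔ R A) :
    prob p n Q = prob p n R := by
  rw [show Q = R from funext fun A => propext (h A)]

theorem prob_fin_zero {Q : Finset (Fin 0) → Prop} (h : Q ∅) : prob p 0 Q = 1 := by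
  unfold prob productMeasure
  rw [Finset.sum_filter,
    Fintype.sum_eq_single ∅ fun A hA => absurd (Subsingleton.elim A ∅) hA]
  simp [h]

/-- Conditioning on the first step; every walk estimate is an induction along this recursion. -/
theorem prob_succ (Q : Finset (Fin (n + 1)) → Prop) :
    prob p (n + 1) Q = p * prob p n (fun A => Q (consStep true A)) +
      (1 - p) * prob p n (fun A => Q (consStep false A)) := by
  classical
  have key : ∀ f : Finset (Fin (n + 1)) → ℝ,
      ∑ A, f A = ∑ A, f (consStep true A) + ∑ A, f (consStep false A) := by
    intro f
    have h : (Finset.univ : Finset (Fin (n + 1))) =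
        insert 0 (Finset.univ.map (Fin.succEmb n)) := by
      ext i; refine Fin.cases ?_ (fun j => ?_) i <;> simp
    have h0 : (0 : Fin (n + 1)) ∉ Finset.univ.map (Fin.succEmb n) := by simp
    rw [← Finset.powerset_univ, h, Finset.sum_powerset_insert h0, add_comm]
    simp only [Finset.map_eq_image, Finset.powerset_image, consStep, if_true]
    rw [Finset.sum_image, Finset.sum_image]
    · simp
    all_goals exact (Finset.image_injective (Fin.succEmb n).injective).injOn
  unfold prob productMeasure
  simp only [Finset.sum_filter]
  rw [key, Finset.mul_sum, Finset.mul_sum]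
  congr 1
  · refine Finset.sum_congr rfl fun A _ => ?_
    rw [card_consStep_true, mul_ite, mul_zero, Nat.add_sub_add_right]
    congr 1; ring
  · refine Finset.sum_congr rfl fun A _ => ?_
    have : A.card ≤ n := by simpa using Finset.card_le_univ A
    rw [card_consStep_false, mul_ite, mul_zero, Nat.succ_sub this, pow_succ]
    congr 1; ring

theorem prob_true : prob p n (fun _ => True) = 1 := by
  induction n with
  | zero => exact prob_fin_zero trivial
  | succ n ih => rw [prob_succ, ih]; ring

theorem prob_le_one (h0 : 0 ≤ p) (h1 : p ≤ 1) (Q : Finset (Fin n) → Prop) : prob p n Q ≤ 1 :=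
  (prob_mono h0 h1 fun _ _ => trivial).trans_eq prob_true

end Measure

/-! ### Hitting probabilities of the walk. -/

section Walk

variable {p α : ℝ}

/-- Walks reach the height `u` with probability at most `(p / (1 - p)) ^ u`. -/
theorem prob_exists_height_le (h0 : 0 < p) (h1 : p < 1) (hα : α * (1 - p) = p)
    (n u : ℕ) : prob p n (fun A => ∃ k, (u : ℤ) ≤ height A k) ≤ α ^ u := by
  have hα0 : 0 ≤ α := by nlinarith
  induction n generalizing u with
  | zero =>
    cases u with
    | zero => simpa using prob_le_one h0.le h1.le _
    | succ u =>
      refine (prob_mono h0.le h1.le (R := fun _ => False) ?_).trans ?_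
      · rintro A ⟨k, hk⟩
        rw [height_of_fin_zero] at hk
        push_cast at hk; omega
      · rw [prob_false]; positivity
  | succ n ih =>
    cases u with
    | zero => simpa using prob_le_one h0.le h1.le _
    | succ u =>
      rw [prob_succ]
      have e1 : prob p n (fun A => ∃ k, ((u + 1 : ℕ) : ℤ) ≤ height (consStep true A) k) ≤ α ^ u := by
        refine (prob_mono h0.le h1.le ?_).trans (ih u)
        rintro A ⟨k, hk⟩
        cases k with
        | zero => rw [height_zero] at hk; push_cast at hk; omega
        | succ k => rw [height_consStep_true] at hk; push_cast at hk; exact ⟨k, by omega⟩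
      have e2 : prob p n (fun A => ∃ k, ((u + 1 : ℕ) : ℤ) ≤ height (consStep false A) k) ≤
          α ^ (u + 2) := by
        refine (prob_mono h0.le h1.le ?_).trans (ih (u + 2))
        rintro A ⟨k, hk⟩
        cases k with
        | zero => rw [height_zero] at hk; push_cast at hk; omega
        | succ k =>
          rw [height_consStep_false] at hk; push_cast at hk ⊢; exact ⟨k, by omega⟩
      -- Gambler's ruin: α solves p + (1 - p)x² = x.
      calc _ ≤ p * α ^ u + (1 - p) * α ^ (u + 2) := by
            have : 0 ≤ 1 - p := by linarith
            gcongr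
        _ = α ^ (u + 1) := by
            rw [pow_add, pow_add]
            linear_combination (-α ^ u + α ^ u * α) * hα

/-- Walks reach the height `u` at two different times with probability at most
`2 p (p / (1 - p)) ^ u`. -/
theorem prob_exists_two_height_le (h0 : 0 < p) (h1 : p < 1) (hα : α * (1 - p) = p)
    (n u : ℕ) :
    prob p n (fun A => ∃ k l, k < l ∧ (u : ℤ) ≤ height A k ∧ (u : ℤ) ≤ height A l) ≤
      2 * p * α ^ u := by
  have hα0 : 0 ≤ α := by nlinarith
  induction n generalizing u with
  | zero =>
    refine (prob_mono h0.le h1.le (R := fun _ => False) ?_).trans ?_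
    · rintro A ⟨k, l, hkl, hk, hl⟩
      rw [height_of_fin_zero] at hk hl
      omega
    · rw [prob_false]; positivity
  | succ n ih =>
    rw [prob_succ]
    have hq : 0 ≤ 1 - p := by linarith
    cases u with
    | zero =>
      have e2 : prob p n (fun A => ∃ k l, k < l ∧ ((0 : ℕ) : ℤ) ≤ height (consStep false A) k ∧
          ((0 : ℕ) : ℤ) ≤ height (consStep false A) l) ≤ α ^ 1 := by
        refine (prob_mono h0.le h1.le ?_).trans (prob_exists_height_le h0 h1 hα n 1)
        rintro A ⟨k, l, hkl, hk, hl⟩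
        cases l with
        | zero => omega
        | succ l => rw [height_consStep_false] at hl; exact ⟨l, by push_cast at hl ⊢; omega⟩
      -- The origin of 2p: a first step up is bounded trivially, and a first step to the right must
      -- be undone by a later climb of 1, for a total of p + (1 - p)α = 2p.
      calc _ ≤ p * 1 + (1 - p) * α ^ 1 := by
            gcongr
            exact prob_le_one h0.le h1.le _
        _ = _ := by linear_combination hα
    | succ u =>
      have e1 : prob p n (fun A => ∃ k l, k < l ∧ ((u + 1 : ℕ) : ℤ) ≤ height (consStep true A) k ∧
          ((u + 1 : ℕ) : ℤ) ≤ height (consStep true A) l) ≤ 2 * p * α ^ u := by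
        refine (prob_mono h0.le h1.le ?_).trans (ih u)
        rintro A ⟨k, l, hkl, hk, hl⟩
        obtain _ | l := l
        · omega
        obtain _ | k := k
        · rw [height_zero] at hk; push_cast at hk; omega
        rw [height_consStep_true] at hk hl
        push_cast at hk hl
        exact ⟨k, l, by omega, by omega, by omega⟩
      have e2 : prob p n (fun A => ∃ k l, k < l ∧ ((u + 1 : ℕ) : ℤ) ≤ height (consStep false A) k ∧
          ((u + 1 : ℕ) : ℤ) ≤ height (consStep false A) l) ≤ 2 * p * α ^ (u + 2) := by
        refine (prob_mono h0.le h1.le ?_).trans (ih (u + 2))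
        rintro A ⟨k, l, hkl, hk, hl⟩
        obtain _ | l := l
        · omega
        obtain _ | k := k
        · rw [height_zero] at hk; push_cast at hk; omega
        rw [height_consStep_false] at hk hl
        push_cast at hk hl ⊢
        exact ⟨k, l, by omega, by omega, by omega⟩
      calc _ ≤ p * (2 * p * α ^ u) + (1 - p) * (2 * p * α ^ (u + 2)) := by gcongr
        _ = 2 * p * α ^ (u + 1) := by
            rw [pow_add, pow_add]
            linear_combination (2 * p * (-α ^ u + α ^ u * α)) * hα

/-- This is a union bound over the m-subsets of [T]; in the induction it becomes Pascal's rule with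
1 - p bounded by 1. -/
theorem prob_card_initialPart_eq_le (h0 : 0 < p) (h1 : p < 1) (n T m : ℕ) :
    prob p n (fun A => (initialPart T A).card = m) ≤ T.choose m * p ^ m := by
  cases m with
  | zero => simpa using prob_le_one h0.le h1.le _
  | succ m =>
  induction n generalizing T m with
  | zero =>
    refine (prob_mono h0.le h1.le (R := fun _ => False) ?_).trans ?_
    · intro A hA
      have : A = ∅ := Subsingleton.elim _ _
      simp [this, initialPart] at hA
    · rw [prob_false]; positivity
  | succ n ih =>
    cases T with
    | zero =>
      refine (prob_mono h0.le h1.le (R := fun _ => False) ?_).trans ?_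
      · intro A hA
        simp [initialPart_zero] at hA
      · rw [prob_false]; positivity
    | succ T =>
      rw [prob_succ]
      simp only [initialPart_consStep_true, initialPart_consStep_false, card_consStep_true,
        card_consStep_false, Nat.add_right_cancel_iff]
      have e1 : prob p n (fun A => (initialPart T A).card = m) ≤ T.choose m * p ^ m := by
        cases m with
        | zero => simpa using prob_le_one h0.le h1.le _
        | succ m => exact ih T m
      have e2 := ih T m
      have e3 := prob_nonneg (n := n) h0.le h1.le (fun A => (initialPart T A).card = m + 1)
      rw [Nat.choose_succ_succ]
      push_cast
      calc _ ≤ p * (T.choose m * p ^ m) + 1 * (T.choose (m + 1) * p ^ (m + 1)) := by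
            gcongr
            linarith
        _ = _ := by ring

/-- The probability that a walk starts with `d` steps to the right and then stays at height at
most `-d`. -/
theorem le_prob_height_le (h0 : 0 < p) (h1 : p < 1) (hα : α * (1 - p) = p) (hα1 : α ≤ 1)
    (n d : ℕ) :
    (1 - p) ^ d * (1 - α) ≤ prob p n (fun A => ∀ l : ℕ, height A l ≤ max (-(l : ℤ)) (-d)) := by
  have hα0 : 0 ≤ α := by nlinarith
  induction d generalizing n with
  | zero =>
    have h := prob_not (p := p) (n := n) (fun A => ∃ k, ((1 : ℕ) : ℤ) ≤ height A k)
    have h2 := prob_exists_height_le h0 h1 hα n 1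
    rw [prob_true] at h
    rw [pow_one] at h2
    rw [pow_zero, one_mul]
    refine le_trans (b := prob p n fun A => ¬ ∃ k, ((1 : ℕ) : ℤ) ≤ height A k) (by linarith)
      (prob_mono h0.le h1.le (fun A hA l => ?_))
    push Not at hA
    have := hA l
    push_cast at this ⊢
    omega
  | succ d ih =>
    have hq : 0 ≤ 1 - p := by linarith
    cases n with
    | zero =>
      -- The ground set may end before `d` steps; the walk then only goes right, so the event is
      -- certain.
      rw [prob_fin_zero fun l => by rw [height_of_fin_zero]; exact le_max_left _ _]
      exact mul_le_one₀ (pow_le_one₀ hq (by linarith)) (by linarith) (by linarith)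
    | succ n =>
      rw [prob_succ]
      have e1 : (1 - p) ^ d * (1 - α) ≤ prob p n (fun A => ∀ l : ℕ,
          height (consStep false A) l ≤ max (-(l : ℤ)) (-(d + 1 : ℕ))) := by
        refine (ih n).trans (prob_mono h0.le h1.le fun A hA l => ?_)
        cases l with
        | zero => simp [height_zero]
        | succ l =>
          have := hA l
          rw [height_consStep_false]
          push_cast
          omega
      have := mul_nonneg h0.le (prob_nonneg (n := n) h0.le h1.le (fun A => ∀ l : ℕ,
          height (consStep true A) l ≤ max (-(l : ℤ)) (-(d + 1 : ℕ))))
      calc _ = (1 - p) * ((1 - p) ^ d * (1 - α)) := by ring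
        _ ≤ _ := by nlinarith [mul_le_mul_of_nonneg_left e1 hq]

/-- The probability that a walk has exactly `i` steps to the right among the first `t` ones,
followed by `s` steps up, by `d` steps to the right, and by a walk that stays below. -/
theorem le_prob_height_profile (h0 : 0 < p) (h1 : p < 1) (hα : α * (1 - p) = p) (hα1 : α ≤ 1)
    (n t i s d : ℕ) (hn : t + s ≤ n) :
    t.choose i * p ^ (t + s) * (1 - p) ^ (i + d) * (1 - α) ≤
      p ^ i * prob p n (fun A => height A t = t - 2 * i ∧ height A (t + s) = t - 2 * i + s ∧
        ∀ l : ℕ, height A (t + s + l) ≤ t - 2 * i + s + max (-(l : ℤ)) (-d)) := by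
  -- The factor `p ^ i` on the right-hand side replaces an exponent t + s - i, avoiding truncated
  -- subtraction; for i > t the binomial vanishes.
  have hq : 0 ≤ 1 - p := by linarith
  induction t generalizing n i with
  | zero =>
    cases i with
    | succ i =>
      simp only [Nat.choose_zero_succ, Nat.cast_zero, zero_mul]
      exact mul_nonneg (pow_nonneg h0.le _) (prob_nonneg h0.le h1.le _)
    | zero =>
      induction s generalizing n with
      | zero =>
        simpa [height_zero] using le_prob_height_le h0 h1 hα hα1 n d
      | succ s ih =>
        obtain _ | n := n
        · omega
        rw [prob_succ]
        have e1 := ih n (by omega)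
        have e2 := prob_nonneg (n := n) h0.le h1.le (fun A =>
          height (consStep false A) 0 = (0 : ℕ) - 2 * (0 : ℕ) ∧
          height (consStep false A) (0 + (s + 1)) = (0 : ℕ) - 2 * (0 : ℕ) + (s + 1 : ℕ) ∧
          ∀ l : ℕ, height (consStep false A) (0 + (s + 1) + l) ≤
            (0 : ℕ) - 2 * (0 : ℕ) + (s + 1 : ℕ) + max (-(l : ℤ)) (-d))
        have e3 : ∀ A : Finset (Fin n), (height (consStep true A) 0 = (0 : ℕ) - 2 * (0 : ℕ) ∧
            height (consStep true A) (0 + (s + 1)) = (0 : ℕ) - 2 * (0 : ℕ) + (s + 1 : ℕ) ∧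
            ∀ l : ℕ, height (consStep true A) (0 + (s + 1) + l) ≤
              (0 : ℕ) - 2 * (0 : ℕ) + (s + 1 : ℕ) + max (-(l : ℤ)) (-d)) ↔
            (height A 0 = (0 : ℕ) - 2 * (0 : ℕ) ∧
            height A (0 + s) = (0 : ℕ) - 2 * (0 : ℕ) + s ∧
            ∀ l : ℕ, height A (0 + s + l) ≤
              (0 : ℕ) - 2 * (0 : ℕ) + s + max (-(l : ℤ)) (-d)) := by
          intro A
          have e : ∀ l, height (consStep true A) (0 + (s + 1) + l) = height A (0 + s + l) + 1 :=
            fun l => by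
              rw [show 0 + (s + 1) + l = (0 + s + l) + 1 by omega, height_consStep_true]
          have e0 := e 0
          rw [add_zero, add_zero] at e0
          simp only [e, e0, height_zero]
          push_cast
          exact and_congr (by simp) (and_congr (by omega) (forall_congr' fun l => by omega))
        rw [prob_congr e3]
        calc _ = p * (((0 : ℕ).choose 0 : ℝ) * p ^ (0 + s) * (1 - p) ^ (0 + d) * (1 - α)) := by
              ring
          _ ≤ _ := by
              rw [pow_zero, one_mul] at e1 ⊢
              nlinarith [mul_le_mul_of_nonneg_left e1 h0.le, mul_nonneg hq e2]
  | succ t ih =>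
    obtain _ | n := n
    · omega
    have e3 : ∀ j : ℕ, ∀ A : Finset (Fin n),
        (height A t = t - 2 * j ∧ height A (t + s) = t - 2 * j + s ∧
          ∀ l : ℕ, height A (t + s + l) ≤ t - 2 * j + s + max (-(l : ℤ)) (-d)) →
        (height (consStep true A) (t + 1) = (t + 1 : ℕ) - 2 * j ∧
          height (consStep true A) (t + 1 + s) = (t + 1 : ℕ) - 2 * j + s ∧
          ∀ l : ℕ, height (consStep true A) (t + 1 + s + l) ≤
            (t + 1 : ℕ) - 2 * j + s + max (-(l : ℤ)) (-d)) := by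
      rintro j A ⟨a1, a2, a3⟩
      rw [show t + 1 + s = t + s + 1 by omega]
      simp only [Nat.add_right_comm _ 1, height_consStep_true]
      push_cast
      exact ⟨by omega, by omega, fun l => by have := a3 l; omega⟩
    have e4 : ∀ j : ℕ, ∀ A : Finset (Fin n),
        (height A t = t - 2 * j ∧ height A (t + s) = t - 2 * j + s ∧
          ∀ l : ℕ, height A (t + s + l) ≤ t - 2 * j + s + max (-(l : ℤ)) (-d)) →
        (height (consStep false A) (t + 1) = (t + 1 : ℕ) - 2 * (j + 1 : ℕ) ∧
          height (consStep false A) (t + 1 + s) = (t + 1 : ℕ) - 2 * (j + 1 : ℕ) + s ∧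
          ∀ l : ℕ, height (consStep false A) (t + 1 + s + l) ≤
            (t + 1 : ℕ) - 2 * (j + 1 : ℕ) + s + max (-(l : ℤ)) (-d)) := by
      rintro j A ⟨a1, a2, a3⟩
      rw [show t + 1 + s = t + s + 1 by omega]
      simp only [Nat.add_right_comm _ 1, height_consStep_false]
      push_cast
      exact ⟨by omega, by omega, fun l => by have := a3 l; omega⟩
    rw [prob_succ]
    cases i with
    | zero =>
      have e1 := (ih n 0 (by omega)).trans (mul_le_mul_of_nonneg_left
        (prob_mono h0.le h1.le (e3 0)) (pow_nonneg h0.le 0))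
      rw [pow_zero, one_mul] at e1 ⊢
      calc _ = p * ((t.choose 0 : ℝ) * p ^ (t + s) * (1 - p) ^ (0 + d) * (1 - α)) := by
            simp only [Nat.choose_zero_right]; ring
        _ ≤ _ := (mul_le_mul_of_nonneg_left e1 h0.le).trans
            (le_add_of_nonneg_right (mul_nonneg hq (prob_nonneg h0.le h1.le _)))
    | succ i =>
      have e1 := (ih n (i + 1) (by omega)).trans (mul_le_mul_of_nonneg_left
        (prob_mono h0.le h1.le (e3 (i + 1))) (pow_nonneg h0.le _))
      have e2 := (ih n i (by omega)).trans (mul_le_mul_of_nonneg_left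
        (prob_mono h0.le h1.le (e4 i)) (pow_nonneg h0.le _))
      rw [Nat.choose_succ_succ]
      push_cast
      calc _ = (1 - p) * p * (t.choose i * p ^ (t + s) * (1 - p) ^ (i + d) * (1 - α)) +
            p * (t.choose (i + 1) * p ^ (t + s) * (1 - p) ^ (i + 1 + d) * (1 - α)) := by ring
        _ ≤ _ := add_le_add (mul_le_mul_of_nonneg_left e2 (mul_nonneg hq h0.le))
            (mul_le_mul_of_nonneg_left e1 h0.le)
        _ = _ := by push_cast; ring

end Walk

/-! ### Cross intersection in terms of heights. -/

section Combinatorics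

variable {n : ℕ}

/-- The walks of members of a cross `t`-intersecting pair, one of which is shifted, have heights
summing to at least `2t` at some common time. -/
theorem IsCrossIntersecting.exists_height_add_height {t : ℕ} {𝒜 ℬ : Finset (Finset (Fin n))}
    (h : IsCrossIntersecting t 𝒜 ℬ) (hs : IsShifted 𝒜) {A B : Finset (Fin n)} (hA : A ∈ 𝒜)
    (hB : B ∈ ℬ) : ∃ k, (2 * t : ℤ) ≤ height A k + height B k := by
  obtain _ | t := t
  · exact ⟨0, by simp [height_zero]⟩
  by_contra! hc
  -- Descent on the sum of the elements of A: shifting a common element of A and B down to a place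
  -- missed by both yields another counterexample in 𝒜.
  induction hw : ∑ i ∈ A, (i : ℕ) using Nat.strong_induction_on generalizing A with
  | _ w ih =>
  have hAB := h A hA B hB
  -- the `(t+1)`-st common element
  have hex : ∃ k, t + 1 ≤ (initialPart k (A ∩ B)).card :=
    ⟨n, by rwa [initialPart, Finset.filter_true_of_mem fun i _ => i.isLt]⟩
  classical
  set k := Nat.find hex with hk
  have hk1 : t + 1 ≤ (initialPart k (A ∩ B)).card := Nat.find_spec hex
  have hk2 : ∀ m < k, (initialPart m (A ∩ B)).card ≤ t := fun m hm => by
    have := Nat.find_min hex hm; omega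
  obtain _ | k' := k
  · rw [initialPart_zero] at hk1; simp at hk1
  have hk3 := hk2 k' (Nat.lt_succ_self _)
  have hxy : ∀ m, (initialPart m A).card + (initialPart m B).card =
      (initialPart m (A ∪ B)).card + (initialPart m (A ∩ B)).card := by
    intro m
    simp only [initialPart, Finset.filter_union, Finset.filter_inter_distrib]
    exact (Finset.card_union_add_card_inter _ _).symm
  have hj : ∃ j : Fin n, (j : ℕ) = k' ∧ j ∈ A ∧ j ∈ B := by
    by_contra! hno
    refine absurd hk1 (not_le.2 (lt_of_le_of_lt (Finset.card_le_card fun i hi => ?_)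
      (Nat.lt_succ_of_le hk3)))
    simp only [initialPart, Finset.mem_filter, Finset.mem_inter] at hi ⊢
    have hne : (i : ℕ) ≠ k' := fun e => hno i e hi.1.1 hi.1.2
    exact ⟨hi.1, by omega⟩
  obtain ⟨j, hjk, hjA, hjB⟩ := hj
  -- If A ∪ B covered everything up to the (t+1)-st common element, the heights there would already
  -- sum to 2(t+1).
  have hgap : ∃ i : Fin n, (i : ℕ) < k' ∧ i ∉ A ∧ i ∉ B := by
    by_contra! hno
    have hcard : k' + 1 ≤ (initialPart (k' + 1) (A ∪ B)).card := by
      have hsub : (Finset.univ.filter fun i : Fin n => (i : ℕ) < k' + 1) ⊆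
          initialPart (k' + 1) (A ∪ B) := by
        intro i hi
        simp only [initialPart, Finset.mem_filter, Finset.mem_univ, true_and,
          Finset.mem_union] at hi ⊢
        refine ⟨?_, hi⟩
        by_cases e : (i : ℕ) = k'
        · rw [show i = j from Fin.ext (e.trans hjk.symm)]; exact Or.inl hjA
        · by_cases hiA : i ∈ A
          · exact Or.inl hiA
          · exact Or.inr (hno i (by omega) hiA)
      refine le_trans (le_of_eq ?_) (Finset.card_le_card hsub)
      rw [Fin.card_filter_val_lt]
      have := j.isLt
      omega
    have := hc (k' + 1)
    have := hxy (k' + 1)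
    simp only [height] at *
    push_cast at *
    omega
  obtain ⟨i, hik, hiA, hiB⟩ := hgap
  have hij : i < j := Fin.lt_def.2 (by omega)
  have hA' := hs A hA i j hij hiA hjA
  refine ih (∑ x ∈ insert i (A.erase j), (x : ℕ)) ?_ hA' ?_ rfl
  · rw [Finset.sum_insert (by simp [hiA]), ← hw, ← Finset.add_sum_erase A _ hjA]
    omega
  -- The shift keeps the heights low: before j the intersection has at most t elements and the union
  -- at most m; after j the counts are unchanged.
  · intro m
    by_cases hm : m < k' + 1
    · have hle : (initialPart m (insert i (A.erase j) ∩ B)).card ≤ t := by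
        refine (Finset.card_le_card fun x hx => ?_).trans (hk2 m hm)
        simp only [initialPart, Finset.mem_filter, Finset.mem_inter, Finset.mem_insert,
          Finset.mem_erase] at hx ⊢
        obtain ⟨⟨h1 | h1, h2⟩, h3⟩ := hx
        · exact absurd (h1 ▸ h2) hiB
        · exact ⟨⟨h1.2, h2⟩, h3⟩
      have hun : (initialPart m (insert i (A.erase j) ∪ B)).card ≤ m := by
        refine (Finset.card_le_card (Finset.filter_subset_filter _ (Finset.subset_univ _))).trans ?_
        rw [Fin.card_filter_val_lt]
        omega
      have : (initialPart m (insert i (A.erase j))).card + (initialPart m B).card =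
          (initialPart m (insert i (A.erase j) ∪ B)).card +
            (initialPart m (insert i (A.erase j) ∩ B)).card := by
        simp only [initialPart, Finset.filter_union, Finset.filter_inter_distrib]
        exact (Finset.card_union_add_card_inter _ _).symm
      simp only [height]
      push_cast
      omega
    · have : (initialPart m (insert i (A.erase j))).card = (initialPart m A).card := by
        simp only [initialPart, Finset.filter_insert, Finset.filter_erase]
        have him : (i : ℕ) < m := by omega
        rw [if_pos him, Finset.card_insert_of_notMem (by simp [hiA]),
          Finset.card_erase_add_one (by simp [hjA]; omega)]
      have h' := hc m
      simp only [height, this] at h' ⊢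
      exact h'

/-- The least maximal height of the walks in a nonempty family. -/
theorem exists_min_max_height {𝒜 : Finset (Finset (Fin n))} (h : 𝒜.Nonempty) :
    ∃ u : ℕ, (∀ A ∈ 𝒜, ∃ k, (u : ℤ) ≤ height A k) ∧ ∃ A ∈ 𝒜, ∀ k, height A k ≤ u := by
  classical
  have hex : ∃ u : ℕ, ∃ A ∈ 𝒜, ∀ k, height A k ≤ u := by
    obtain ⟨A, hA⟩ := h
    refine ⟨2 * A.card, A, hA, fun k => ?_⟩
    have : (initialPart k A).card ≤ A.card := Finset.card_filter_le _ _
    simp only [height]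
    push_cast
    omega
  refine ⟨Nat.find hex, fun A hA => ?_, Nat.find_spec hex⟩
  by_contra! hc
  rcases hu : Nat.find hex with _ | u
  · have := hc 0
    rw [hu, height_zero] at this
    simp at this
  · refine Nat.find_min hex (m := u) (by omega) ⟨A, hA, fun k => ?_⟩
    have := hc k
    rw [hu] at this
    push_cast at this
    omega

end Combinatorics

/-! ### Peaks of walks and the structure of nice pairs. -/

section Structure

variable {n : ℕ} {p α : ℝ}

theorem IsCrossIntersecting.symm {t : ℕ} {𝒜 ℬ : Finset (Finset (Fin n))}
    (h : IsCrossIntersecting t 𝒜 ℬ) : IsCrossIntersecting t ℬ 𝒜 := fun B hB A hA => by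
  rw [Finset.inter_comm]; exact h A hA B hB

theorem IsNice.symm {t : ℕ} {𝒜 ℬ : Finset (Finset (Fin n))} (h : IsNice t 𝒜 ℬ) : IsNice t ℬ 𝒜 :=
  ⟨h.shifted_right, h.shifted_left, h.maximal_right, h.maximal_left, h.cross.symm⟩

/-- The walk of `A` has maximal height `u`, attained at time `T` only. -/
def PeaksOnlyAt (A : Finset (Fin n)) (T : ℕ) (u : ℤ) : Prop :=
  height A T = u ∧ ∀ k ≠ T, height A k < u

theorem PeaksOnlyAt.height_le {A : Finset (Fin n)} {T : ℕ} {u : ℤ} (h : PeaksOnlyAt A T u)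
    (k : ℕ) : height A k ≤ u := by
  by_cases hk : k = T
  · rw [hk]; exact h.1.le
  · exact (h.2 k hk).le

/-- Steps up have size one, so a walk above u at time T was already at height at least u one step
earlier, giving two such times. -/
theorem exists_peaksOnlyAt {A : Finset (Fin n)} {u : ℕ} (h : ∃ k, (u : ℤ) ≤ height A k)
    (h' : ¬ ∃ k l, k < l ∧ (u : ℤ) ≤ height A k ∧ (u : ℤ) ≤ height A l) :
    ∃ T, PeaksOnlyAt A T u := by
  obtain ⟨T, hT⟩ := h
  push Not at h'
  refine ⟨T, le_antisymm ?_ hT, fun k hk => ?_⟩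
  · by_contra! hlt
    obtain _ | T := T
    · rw [height_zero] at hlt; omega
    · have h1 := height_add_le A T 1
      have := h' T (T + 1) (Nat.lt_succ_self T) (by push_cast at h1; omega)
      omega
  · rcases lt_or_gt_of_ne hk with hk | hk
    · by_contra! hle
      exact absurd hT (not_le.2 (h' k T hk hle))
    · exact h' T k hk hT

/-- With u + v = 2t, the common time of height sum 2t must be a maximum of both walks. -/
theorem PeaksOnlyAt.time_eq {A B : Finset (Fin n)} {S T t : ℕ} {u v : ℤ}
    (hA : PeaksOnlyAt A S u) (hB : PeaksOnlyAt B T v) (huv : u + v = 2 * t)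
    (h : ∃ k, (2 * t : ℤ) ≤ height A k + height B k) : S = T := by
  obtain ⟨k, hk⟩ := h
  have h1 := hA.height_le k
  have h2 := hB.height_le k
  have hS : k = S := by
    by_contra hne
    have := hA.2 k hne
    omega
  have hT : k = T := by
    by_contra hne
    have := hB.2 k hne
    omega
  exact hS.symm.trans hT

/-- A family all of whose walks reach height `u`, where those that do so only once do it at
time `T`. -/
theorem productMeasure_le_of_peaksOnlyAt (h0 : 0 < p) (h1 : p < 1) (hα : α * (1 - p) = p)
    {𝒜 : Finset (Finset (Fin n))} {u T : ℕ} (hu : ∀ A ∈ 𝒜, ∃ k, (u : ℤ) ≤ height A k)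
    (hT : ∀ A ∈ 𝒜, ∀ S, PeaksOnlyAt A S u → S = T) :
    productMeasure p 𝒜 ≤ 2 * p * α ^ u + prob p n (fun A => height A T = u) := by
  refine le_trans ?_ (add_le_add (prob_exists_two_height_le h0 h1 hα n u) le_rfl)
  refine le_trans (productMeasure_le_prob h0.le h1.le fun A hA => ?_) (prob_or_le h0.le h1.le _ _)
  by_cases hb : ∃ k l, k < l ∧ (u : ℤ) ≤ height A k ∧ (u : ℤ) ≤ height A l
  · exact Or.inl hb
  · obtain ⟨S, hS⟩ := exists_peaksOnlyAt (hu A hA) hb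
    exact Or.inr (hT A hA S hS ▸ hS.1)

theorem prob_height_eq_le (h0 : 0 < p) (h1 : p < 1) (n i c : ℕ) :
    prob p n (fun A => height A (c + i) = c - i) ≤ (c + i).choose i * p ^ c := by
  have : (c + i).choose i = (c + i).choose c := by
    rw [Nat.choose_symm_add]
  rw [this]
  refine (prob_mono h0.le h1.le fun A hA => ?_).trans (prob_card_initialPart_eq_le h0 h1 n _ c)
  simp only [height] at hA
  push_cast at hA
  omega

/-- Either the product of the measures of a nice pair is small, or all walks of the two families
that reach the minimal maximal height only once do so at a common time. -/
theorem IsNice.product_small_or_peak {t : ℕ} {𝒜 ℬ : Finset (Finset (Fin n))}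
    (h : IsNice t 𝒜 ℬ) (hA : 𝒜.Nonempty) (hB : ℬ.Nonempty) (h0 : 0 < p) (h1 : p < 1)
    (hα : α * (1 - p) = p) (hα1 : α ≤ 1) :
    productMeasure p 𝒜 * productMeasure p ℬ ≤ α ^ (2 * t + 1) ∨
    productMeasure p 𝒜 * productMeasure p ℬ ≤ 2 * p * α ^ (2 * t) ∨
    ∃ i j : ℕ,
      (∃ A ∈ 𝒜, PeaksOnlyAt A (t + i + j) (t + j - i)) ∧
      (∃ B ∈ ℬ, PeaksOnlyAt B (t + i + j) (t + i - j)) ∧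
      productMeasure p 𝒜 * productMeasure p ℬ ≤
        (t + i + j).choose i * (t + i + j).choose j * p ^ (2 * t + (i + j)) +
          8 * p * α ^ (2 * t) := by
  have hα0 : 0 ≤ α := by
    by_contra! hneg
    nlinarith
  obtain ⟨u, hu, A₀, hA₀, hA₀u⟩ := exists_min_max_height hA
  obtain ⟨v, hv, B₀, hB₀, hB₀v⟩ := exists_min_max_height hB
  have huv : 2 * t ≤ u + v := by
    obtain ⟨k, hk⟩ := h.cross.exists_height_add_height h.shifted_left hA₀ hB₀
    have := hA₀u k
    have := hB₀v k
    omega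
  have mA : productMeasure p 𝒜 ≤ α ^ u :=
    (productMeasure_le_prob h0.le h1.le hu).trans (prob_exists_height_le h0 h1 hα n u)
  have mB : productMeasure p ℬ ≤ α ^ v :=
    (productMeasure_le_prob h0.le h1.le hv).trans (prob_exists_height_le h0 h1 hα n v)
  have nA := productMeasure_nonneg h0.le h1.le 𝒜
  have nB := productMeasure_nonneg h0.le h1.le ℬ
  rcases huv.lt_or_eq with hlt | heq
  · left
    calc _ ≤ α ^ u * α ^ v := by gcongr
      _ = α ^ (u + v) := (pow_add _ _ _).symm
      _ ≤ _ := pow_le_pow_of_le_one hα0 hα1 hlt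
  right
  have hpow : α ^ u * α ^ v = α ^ (2 * t) := by rw [← pow_add, heq]
  by_cases bA : ∀ A ∈ 𝒜, ∃ k l, k < l ∧ (u : ℤ) ≤ height A k ∧ (u : ℤ) ≤ height A l
  · left
    have mA' : productMeasure p 𝒜 ≤ 2 * p * α ^ u :=
      (productMeasure_le_prob h0.le h1.le bA).trans (prob_exists_two_height_le h0 h1 hα n u)
    calc _ ≤ 2 * p * α ^ u * α ^ v := by gcongr
      _ = _ := by rw [← hpow]; ring
  by_cases bB : ∀ B ∈ ℬ, ∃ k l, k < l ∧ (v : ℤ) ≤ height B k ∧ (v : ℤ) ≤ height B l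
  · left
    have mB' : productMeasure p ℬ ≤ 2 * p * α ^ v :=
      (productMeasure_le_prob h0.le h1.le bB).trans (prob_exists_two_height_le h0 h1 hα n v)
    calc _ ≤ α ^ u * (2 * p * α ^ v) := by gcongr
      _ = _ := by rw [← hpow]; ring
  right
  rw [not_forall] at bA bB
  obtain ⟨A₁, hA₁⟩ := bA
  obtain ⟨B₁, hB₁⟩ := bB
  rw [Classical.not_imp] at hA₁ hB₁
  obtain ⟨hA₁, gA⟩ := hA₁
  obtain ⟨hB₁, gB⟩ := hB₁
  obtain ⟨T, hT⟩ := exists_peaksOnlyAt (hu _ hA₁) gA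
  obtain ⟨T', hT'⟩ := exists_peaksOnlyAt (hv _ hB₁) gB
  have huv' : (u : ℤ) + v = 2 * t := by exact_mod_cast heq.symm
  obtain rfl : T = T' :=
    hT.time_eq hT' huv' (h.cross.exists_height_add_height h.shifted_left hA₁ hB₁)
  have tA : ∀ A ∈ 𝒜, ∀ S, PeaksOnlyAt A S u → S = T := fun A hA S hS =>
    hS.time_eq hT' huv' (h.cross.exists_height_add_height h.shifted_left hA hB₁)
  have tB : ∀ B ∈ ℬ, ∀ S, PeaksOnlyAt B S v → S = T := fun B hB S hS =>
    (hT.time_eq hS huv' (h.cross.exists_height_add_height h.shifted_left hA₁ hB)).symm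
  have mA' := productMeasure_le_of_peaksOnlyAt h0 h1 hα hu tA
  have mB' := productMeasure_le_of_peaksOnlyAt h0 h1 hα hv tB
  -- `i` and `j` count the steps to the right before the peak; u + v = 2t then gives T = t + i + j.
  obtain ⟨i, hi⟩ : ∃ i : ℕ, (u : ℤ) + 2 * i = T := by
    have h2 := hT.1
    have h3 := height_le A₁ T
    simp only [height] at h2 h3
    exact ⟨T - (initialPart T A₁).card, by omega⟩
  obtain ⟨j, hj⟩ : ∃ j : ℕ, (v : ℤ) + 2 * j = T := by
    have h2 := hT'.1
    have h3 := height_le B₁ T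
    simp only [height] at h2 h3
    exact ⟨T - (initialPart T B₁).card, by omega⟩
  obtain rfl : T = t + i + j := by omega
  have hu' : (u : ℤ) = t + j - i := by omega
  have hv' : (v : ℤ) = t + i - j := by omega
  refine ⟨i, j, ⟨A₁, hA₁, hu' ▸ hT⟩, ⟨B₁, hB₁, hv' ▸ hT'⟩, ?_⟩
  set f := prob p n (fun A => height A (t + i + j) = u) with hf
  set g := prob p n (fun A => height A (t + i + j) = v) with hg
  have f0 : 0 ≤ f := prob_nonneg h0.le h1.le _
  have g0 : 0 ≤ g := prob_nonneg h0.le h1.le _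
  have f1 : f ≤ α ^ u := (prob_mono h0.le h1.le fun A hA => ⟨_, hA.ge⟩).trans
    (prob_exists_height_le h0 h1 hα n u)
  have g1 : g ≤ α ^ v := (prob_mono h0.le h1.le fun A hA => ⟨_, hA.ge⟩).trans
    (prob_exists_height_le h0 h1 hα n v)
  have f2 : f ≤ (t + i + j).choose i * p ^ (t + j) := by
    have := prob_height_eq_le h0 h1 n i (t + j)
    rwa [Nat.add_right_comm t j i, Nat.cast_add, ← hu'] at this
  have g2 : g ≤ (t + i + j).choose j * p ^ (t + i) := by
    have := prob_height_eq_le h0 h1 n j (t + i)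
    rwa [Nat.cast_add, ← hv'] at this
  have hfg : f * g ≤ (t + i + j).choose i * (t + i + j).choose j * p ^ (2 * t + (i + j)) := by
    calc f * g ≤ _ := mul_le_mul f2 g2 g0 (by positivity)
      _ = _ := by ring
  have hfv : f * α ^ v ≤ α ^ (2 * t) := hpow ▸ mul_le_mul_of_nonneg_right f1 (by positivity)
  have hgu : α ^ u * g ≤ α ^ (2 * t) := hpow ▸ mul_le_mul_of_nonneg_left g1 (by positivity)
  have hpp : p * p * α ^ (2 * t) ≤ p * α ^ (2 * t) := by
    have : 0 ≤ p * α ^ (2 * t) := by positivity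
    nlinarith
  -- The cross terms contribute 2 + 2 and the square term 4, using p² ≤ p, whence the constant 8.
  calc _ ≤ (2 * p * α ^ u + f) * (2 * p * α ^ v + g) := mul_le_mul mA' mB' nB (by positivity)
    _ = f * g + 2 * (p * (α ^ u * g)) + 2 * (p * (f * α ^ v)) +
        4 * (p * p * (α ^ u * α ^ v)) := by ring
    _ ≤ _ := by
      rw [hpow]
      have := mul_le_mul_of_nonneg_left hfv h0.le
      have := mul_le_mul_of_nonneg_left hgu h0.le
      linarith

/-- If `ℬ` contains a set peaking only at `(t + 2r, t)`, then sets of `𝒜` outside `ℱ^t_r` force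
`ℬ` to miss a sizeable part of `ℱ^t_r`. -/
theorem IsNice.sdiff_franklFamily {t r : ℕ} {𝒜 ℬ : Finset (Finset (Fin n))}
    (h : IsNice t 𝒜 ℬ) (hn : t + 2 * r ≤ n) (h0 : 0 < p) (h1 : p < 1)
    (hα : α * (1 - p) = p) (hα1 : α ≤ 1) (hB : ∃ B ∈ ℬ, PeaksOnlyAt B (t + 2 * r) t) :
    𝒜 \ franklFamily n t r = ∅ ∨ ∃ d : ℕ, 1 ≤ d ∧
      productMeasure p (𝒜 \ franklFamily n t r) ≤ α ^ (t + d) ∧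
      t.choose r * p ^ (t + 2 * r) * (1 - p) ^ (r + (d + 1)) * (1 - α) ≤
        p ^ r * productMeasure p (franklFamily n t r \ ℬ) := by
  rcases Finset.eq_empty_or_nonempty (𝒜 \ franklFamily n t r) with he | hne
  · exact Or.inl he
  right
  obtain ⟨B₁, hB₁, hpk⟩ := hB
  obtain ⟨m, hm, A, hA, hAm⟩ := exists_min_max_height hne
  rw [Finset.mem_sdiff, mem_franklFamily] at hA
  -- Heights at a fixed time have fixed parity, so failing to reach t costs 2.
  have hAT : height A (t + 2 * r) ≤ t - 2 := by
    have := hA.2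
    simp only [height] at this ⊢
    push_cast at this ⊢
    omega
  -- The meeting with B₁ cannot occur at its peak, so B₁ is below t there and A above t.
  have htm : t + 1 ≤ m := by
    obtain ⟨k, hk⟩ := h.cross.exists_height_add_height h.shifted_left hA.1 hB₁
    have := hAm k
    by_cases hkT : k = t + 2 * r
    · subst hkT
      have := hpk.1
      omega
    · have := hpk.2 k hkT
      omega
  obtain ⟨d, rfl⟩ := Nat.exists_eq_add_of_le (Nat.le_of_succ_le htm)
  refine ⟨d, by omega, (productMeasure_le_prob h0.le h1.le hm).trans
    (prob_exists_height_le h0 h1 hα n _), ?_⟩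
  refine (le_prob_height_profile h0 h1 hα hα1 n t r (2 * r) (d + 1) hn).trans
    (mul_le_mul_of_nonneg_left (prob_le_productMeasure h0.le h1.le ?_) (pow_nonneg h0.le _))
  -- Such a B meets A nowhere: up to time t + 2r the sum is at most 2t - 1; afterwards B falls at
  -- the rate A can climb, until it is d + 1 below t while A never exceeds t + d.
  rintro B ⟨b1, b2, b3⟩
  rw [Finset.mem_sdiff, mem_franklFamily]
  refine ⟨by push_cast at b2; omega, fun hBB => ?_⟩
  obtain ⟨k, hk⟩ := h.cross.exists_height_add_height h.shifted_left hA.1 hBB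
  rcases lt_or_ge k t with hkt | hkt
  · have := height_le A k
    have := height_le B k
    omega
  rcases le_total k (t + 2 * r) with hkT | hkT
  · obtain ⟨l, hl⟩ := Nat.exists_eq_add_of_le hkT
    obtain ⟨l', rfl⟩ := Nat.exists_eq_add_of_le hkt
    have e1 := height_sub_le A (t + l') l
    have e2 := height_add_le B t l'
    rw [← hl] at e1
    omega
  · obtain ⟨l, rfl⟩ := Nat.exists_eq_add_of_le hkT
    have e1 := height_add_le A (t + 2 * r) l
    have e2 := hAm (t + 2 * r + l)
    have e3 := b3 l
    push_cast at e2 e3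
    omega

/-- Only sets missing exactly r elements of [t + 2r] are counted. The loss 1 - α comes from reusing
the profile bound with s = d = 0 and is harmless for small p. -/
theorem le_productMeasure_franklFamily {t r : ℕ} (hn : t + 2 * r ≤ n) (h0 : 0 < p) (h1 : p < 1)
    (hα : α * (1 - p) = p) (hα1 : α ≤ 1) :
    (t + 2 * r).choose r * p ^ (t + r) * (1 - p) ^ r * (1 - α) ≤
      productMeasure p (franklFamily n t r) := by
  have h := le_prob_height_profile h0 h1 hα hα1 n (t + 2 * r) r 0 0 hn
  have h2 := h.trans (mul_le_mul_of_nonneg_left (prob_le_productMeasure h0.le h1.le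
    (𝒜 := franklFamily n t r) fun A hA => ?_) (pow_nonneg h0.le r))
  · refine le_of_mul_le_mul_left (le_trans (le_of_eq ?_) h2) (pow_pos h0 r)
    ring
  · rw [mem_franklFamily, hA.1]
    push_cast
    omega

end Structure

/-! ### Numerical estimates for p of order 1/t. -/

section Estimates

open scoped Nat

theorem pow_div_factorial_succ (x : ℝ) (k : ℕ) :
    x ^ (k + 1) / (k + 1)! = x / (k + 1) * (x ^ k / k !) := by
  rw [Nat.factorial_succ, pow_succ]
  push_cast
  have : (k ! : ℝ) ≠ 0 := by positivity
  field_simp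

theorem pow_div_factorial_le_of_le {x : ℝ} {i k : ℕ} (hik : i ≤ k) (hx : (k : ℝ) ≤ x) :
    x ^ i / i ! ≤ x ^ k / k ! := by
  induction k, hik using Nat.le_induction with
  | base => exact le_rfl
  | succ k _ ih =>
    push_cast at hx
    have hk : (0 : ℝ) ≤ k := k.cast_nonneg
    have hx0 : 0 ≤ x := by linarith
    refine (ih (by linarith)).trans ?_
    rw [pow_div_factorial_succ]
    refine le_mul_of_one_le_left (by positivity) ?_
    rw [le_div_iff₀ (by positivity)]
    linarith

theorem pow_div_factorial_le_of_ge {x : ℝ} {i k : ℕ} (hki : k ≤ i) (hx0 : 0 ≤ x)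
    (hx : x ≤ k + 1) : x ^ i / i ! ≤ x ^ k / k ! := by
  induction i, hki using Nat.le_induction with
  | base => exact le_rfl
  | succ i hi ih =>
    refine le_trans ?_ ih
    rw [pow_div_factorial_succ]
    refine mul_le_of_le_one_left (by positivity) ?_
    rw [div_le_one (by positivity)]
    have : (k : ℝ) ≤ i := by exact_mod_cast hi
    linarith

/-- The terms `x ^ i / i!` are maximal at `i = r`, with a gap. -/
theorem pow_div_factorial_le_gap {x ε : ℝ} {r i : ℕ} (hε : 0 < ε) (hε' : ε < 1 / 2)
    (hx : r + ε ≤ x) (hx' : x ≤ r + 1 - ε) (hi : i ≠ r) :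
    x ^ i / i ! ≤ (1 - ε / (r + 1)) * (x ^ r / r !) := by
  have hr : (0 : ℝ) ≤ r := r.cast_nonneg
  have hx0 : 0 < x := by linarith
  -- The sequence is unimodal, so only the neighbours of r matter: the ratios x/(r+1) and r/x are
  -- both at most (r+1-ε)/(r+1).
  have hrho : 1 - ε / (r + 1) = (r + 1 - ε) / (r + 1) := by field_simp
  rcases lt_or_gt_of_ne hi with h | h
  · obtain _ | k := r
    · omega
    push_cast at *
    have h1 := pow_div_factorial_le_of_le (x := x) (Nat.le_of_lt_succ h) (by linarith)
    refine h1.trans ?_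
    rw [pow_div_factorial_succ, ← mul_assoc]
    refine le_mul_of_one_le_left (by positivity) ?_
    rw [hrho, div_mul_div_comm, le_div_iff₀ (by positivity)]
    nlinarith
  · have h1 := pow_div_factorial_le_of_ge (x := x) (k := r + 1) h hx0.le
      (by push_cast; linarith)
    refine h1.trans ?_
    rw [pow_div_factorial_succ, hrho]
    gcongr

theorem one_le_pow_div_factorial {x : ℝ} {r : ℕ} (hx : (r : ℝ) ≤ x) : 1 ≤ x ^ r / r ! := by
  simpa using pow_div_factorial_le_of_le (Nat.zero_le r) hx

theorem choose_mul_pow_le_pow_div_factorial {p : ℝ} (h0 : 0 ≤ p) (T i : ℕ) :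
    T.choose i * p ^ i ≤ (p * T) ^ i / i ! := by
  calc _ ≤ (T : ℝ) ^ i / i ! * p ^ i := by
        gcongr
        exact Nat.choose_le_pow_div i T
    _ = _ := by rw [mul_pow]; ring

theorem pow_div_factorial_le_choose_mul_pow {p : ℝ} (h0 : 0 ≤ p) {m T i : ℕ}
    (h : m + i ≤ T + 1) : (p * m) ^ i / i ! ≤ T.choose i * p ^ i := by
  calc _ = (m : ℝ) ^ i / i ! * p ^ i := by rw [mul_pow]; ring
    _ ≤ ((T + 1 - i : ℕ) : ℝ) ^ i / i ! * p ^ i := by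
        gcongr
        omega
    _ ≤ _ := by
        gcongr
        exact_mod_cast Nat.pow_le_choose i T

theorem choose_mul_pow_le_one_add_pow {w : ℝ} (hw : 0 ≤ w) (T i : ℕ) :
    T.choose i * w ^ i ≤ (1 + w) ^ T := by
  by_cases h : i ≤ T
  · rw [add_comm, add_pow]
    refine le_trans (le_of_eq ?_) (Finset.single_le_sum
      (f := fun m => w ^ m * 1 ^ (T - m) * (T.choose m : ℝ)) (fun _ _ => by positivity)
      (Finset.mem_range.2 (Nat.lt_succ_of_le h)))
    simp [mul_comm]
  · rw [Nat.choose_eq_zero_of_lt (not_le.1 h)]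
    simp only [Nat.cast_zero, zero_mul]
    positivity

theorem one_add_two_mul_pow_le_exp {p c : ℝ} {t : ℕ} (h0 : 0 ≤ p) (h : p * t ≤ c) :
    (1 + 2 * p) ^ t ≤ Real.exp (2 * c) := by
  calc _ ≤ Real.exp (2 * p) ^ t := by
        gcongr
        linarith [Real.add_one_le_exp (2 * p)]
    _ = Real.exp (2 * (p * t)) := by rw [← Real.exp_nat_mul]; ring_nf
    _ ≤ _ := by gcongr

/-- Since α ≤ p(1 + 2p) and pt is bounded, replacing the odds by p costs only a constant factor. -/
theorem odds_pow_le {p α c : ℝ} {t : ℕ} (h0 : 0 < p) (h1 : p ≤ 1 / 10) (hα : α * (1 - p) = p)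
    (h : p * t ≤ c) : α ^ t ≤ p ^ t * Real.exp (2 * c) := by
  have hα0 : 0 ≤ α := by
    by_contra! hneg
    nlinarith
  have hle : α ≤ p * (1 + 2 * p) := by
    refine le_of_mul_le_mul_right ?_ (by linarith : 0 < 1 - p)
    rw [hα]
    nlinarith [mul_nonneg (sq_nonneg p) (by linarith : 0 ≤ 1 - 2 * p)]
  calc α ^ t ≤ (p * (1 + 2 * p)) ^ t := by gcongr
    _ = p ^ t * (1 + 2 * p) ^ t := mul_pow _ _ _
    _ ≤ _ := by gcongr; exact one_add_two_mul_pow_le_exp h0.le h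

/-- Weighting with 2p instead of p gains 2^(-(i+j)), while the growth of (1 + 2p)^2 costs at most
3/2 per unit of i + j; this leaves geometric decay at rate 3/4. -/
theorem choose_mul_choose_le_of_large {p c : ℝ} {t i j : ℕ} (h0 : 0 < p) (h1 : p ≤ 1 / 10)
    (h : p * t ≤ c) :
    (t + i + j).choose i * (t + i + j).choose j * p ^ (2 * t + (i + j)) ≤
      p ^ (2 * t) * (Real.exp (2 * c) ^ 2 * (3 / 4) ^ (i + j)) := by
  have e1 := choose_mul_pow_le_one_add_pow (w := 2 * p) (by linarith) (t + i + j) i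
  have e2 := choose_mul_pow_le_one_add_pow (w := 2 * p) (by linarith) (t + i + j) j
  have e3 := one_add_two_mul_pow_le_exp h0.le h
  refine le_of_mul_le_mul_left ?_ (pow_pos (two_pos (α := ℝ)) (i + j))
  calc (2 : ℝ) ^ (i + j) *
        ((t + i + j).choose i * (t + i + j).choose j * p ^ (2 * t + (i + j)))
      = p ^ (2 * t) * (((t + i + j).choose i * (2 * p) ^ i) *
          ((t + i + j).choose j * (2 * p) ^ j)) := by
        rw [mul_pow, mul_pow]; ring
    _ ≤ p ^ (2 * t) * ((1 + 2 * p) ^ (t + i + j) * (1 + 2 * p) ^ (t + i + j)) := by gcongr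
    _ = p ^ (2 * t) * (((1 + 2 * p) ^ t) ^ 2 * ((1 + 2 * p) ^ 2) ^ (i + j)) := by
        generalize 1 + 2 * p = w
        ring
    _ ≤ p ^ (2 * t) * (Real.exp (2 * c) ^ 2 * (2 * (3 / 4)) ^ (i + j)) := by
        gcongr
        nlinarith
    _ = _ := by rw [mul_pow]; ring

/-- For bounded i + j, p(t+i+j) is within a factor 1 + S/t of x, and an index other than r triggers
the gap. -/
theorem choose_mul_choose_le_of_small {p x ε : ℝ} {r t i j S : ℕ} (hε : 0 < ε)
    (hε' : ε < 1 / 2) (ht : 0 < t) (h0 : 0 < p) (hx : p * t = x) (hxl : r + ε ≤ x)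
    (hxu : x ≤ r + 1 - ε) (hij : ¬ (i = r ∧ j = r)) (hS : i + j ≤ S) :
    (t + i + j).choose i * (t + i + j).choose j * p ^ (2 * t + (i + j)) ≤
      p ^ (2 * t) * (x ^ r / r !) ^ 2 * ((1 - ε / (r + 1)) * (1 + S / t) ^ S) := by
  have ht' : (0 : ℝ) < t := by exact_mod_cast ht
  have hr : (0 : ℝ) ≤ r := r.cast_nonneg
  have hx0 : 0 < x := by linarith
  have hρ : 1 - ε / (r + 1) ≤ 1 := by
    have : 0 ≤ ε / (r + 1) := by positivity
    linarith
  have e1 := choose_mul_pow_le_pow_div_factorial h0.le (t + i + j) i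
  have e2 := choose_mul_pow_le_pow_div_factorial h0.le (t + i + j) j
  have hT : p * (t + i + j : ℕ) ≤ x * (1 + S / t) := by
    have : ((i + j : ℕ) : ℝ) ≤ S := by exact_mod_cast hS
    rw [← hx]
    calc p * (t + i + j : ℕ) = p * (t + (i + j : ℕ)) := by push_cast; ring
      _ ≤ p * (t + S) := by gcongr
      _ = _ := by field_simp
  have hz : (1 : ℝ) ≤ 1 + S / t := by
    have : (0 : ℝ) ≤ S / t := by positivity
    linarith
  have hy := one_le_pow_div_factorial (r := r) (x := x) (by linarith)
  have hle : ∀ k : ℕ, x ^ k / k ! ≤ x ^ r / r ! := by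
    intro k
    by_cases hk : k = r
    · rw [hk]
    · refine (pow_div_factorial_le_gap hε hε' hxl hxu hk).trans ?_
      exact mul_le_of_le_one_left (by linarith) hρ
  have hyy : x ^ i / i ! * (x ^ j / j !) ≤ (1 - ε / (r + 1)) * (x ^ r / r !) ^ 2 := by
    by_cases hi : i = r
    · have hj : j ≠ r := fun hj => hij ⟨hi, hj⟩
      calc _ ≤ x ^ r / r ! * ((1 - ε / (r + 1)) * (x ^ r / r !)) :=
            mul_le_mul (hle i) (pow_div_factorial_le_gap hε hε' hxl hxu hj) (by positivity)
              (by positivity)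
        _ = _ := by ring
    · calc _ ≤ ((1 - ε / (r + 1)) * (x ^ r / r !)) * (x ^ r / r !) :=
            mul_le_mul (pow_div_factorial_le_gap hε hε' hxl hxu hi) (hle j) (by positivity)
              (le_trans (by positivity) (pow_div_factorial_le_gap hε hε' hxl hxu hi))
        _ = _ := by ring
  calc ((t + i + j).choose i : ℝ) * (t + i + j).choose j * p ^ (2 * t + (i + j))
      = p ^ (2 * t) * (((t + i + j).choose i * p ^ i) * ((t + i + j).choose j * p ^ j)) := by
        ring
    _ ≤ p ^ (2 * t) * (((p * (t + i + j : ℕ)) ^ i / i !) * ((p * (t + i + j : ℕ)) ^ j / j !)) := by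
        gcongr
    _ ≤ p ^ (2 * t) * (((x * (1 + S / t)) ^ i / i !) * ((x * (1 + S / t)) ^ j / j !)) := by
        gcongr
    _ = p ^ (2 * t) * ((x ^ i / i ! * (x ^ j / j !)) * (1 + S / t) ^ (i + j)) := by
        rw [mul_pow, mul_pow]; ring
    _ ≤ p ^ (2 * t) * (((1 - ε / (r + 1)) * (x ^ r / r !) ^ 2) * (1 + S / t) ^ S) := by
        have : (0 : ℝ) ≤ (1 - ε / (r + 1)) * (x ^ r / r !) ^ 2 :=
          le_trans (by positivity) hyy
        gcongr
    _ = _ := by ring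

/-- The two-family stability inequality in terms of the measures of the differences. -/
theorem add_le_of_product_ge {F a a' b b' η C δ : ℝ} (hδ : δ ≤ 1) (hC : 2 < C)
    (hη : η * (C + 2) = C - 2) (hab : a ≤ η * b') (hba : b ≤ η * a')
    (hX : 0 ≤ F + a - a') (hY : 0 ≤ F + b - b')
    (h : (1 - δ) * F ^ 2 ≤ (F + a - a') * (F + b - b')) :
    (a + a') + (b + b') ≤ C * (1 - Real.sqrt (1 - δ)) * F := by
  set s := Real.sqrt (1 - δ) with hs
  have hs2 : s ^ 2 = 1 - δ := Real.sq_sqrt (by linarith)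
  have hs0 : 0 ≤ s := Real.sqrt_nonneg _
  -- AM-GM for the two measures.
  have hsum : 2 * s * F ≤ (F + a - a') + (F + b - b') := by
    refine le_of_sq_le_sq ?_ (by linarith)
    rw [← hs2] at h
    nlinarith [sq_nonneg ((F + a - a') - (F + b - b'))]
  have hη1 : η < 1 := by
    by_contra! hge
    nlinarith
  have h1 : (1 - η) * (a' + b') ≤ 2 * (1 - s) * F := by linarith
  have h2 : (a + a') + (b + b') ≤ (1 + η) * (a' + b') := by linarith
  have hC2 : 0 < C + 2 := by linarith
  -- The choice of η makes 2(1 + η)/(1 - η) equal to C.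
  refine le_of_mul_le_mul_left ?_ hC2
  have h3 := mul_le_mul_of_nonneg_left h2 hC2.le
  have h4 := mul_le_mul_of_nonneg_left h1 hC2.le
  have e3 : (C + 2) * ((1 + η) * (a' + b')) = 2 * C * (a' + b') := by
    linear_combination (a' + b') * hη
  have e4 : (C + 2) * ((1 - η) * (a' + b')) = 4 * (a' + b') := by
    linear_combination (-(a' + b')) * hη
  rw [e3] at h3
  rw [e4] at h4
  have h5 := mul_le_mul_of_nonneg_left h4 (by linarith : (0 : ℝ) ≤ C / 2)
  linarith

/-- Both sides carry p^t(1 - p)^d, so the comparison is uniform in d; the left has a further factor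
p because d ≥ 1. -/
theorem odds_pow_le_of_profile {p α c η M : ℝ} {t r d : ℕ} (h0 : 0 < p) (h1 : p ≤ 1 / 10)
    (hα : α * (1 - p) = p) (hpt : p * t ≤ c) (hr : (r : ℝ) ≤ p * t) (ht : 2 * r ≤ t) (hd : 1 ≤ d)
    (hη : Real.exp (2 * c) * (4 * p) * 2 ^ (2 * r + 2) ≤ η) (hη0 : 0 ≤ η)
    (h : t.choose r * p ^ (t + 2 * r) * (1 - p) ^ (r + (d + 1)) * (1 - α) ≤ p ^ r * M) :
    α ^ (t + d) ≤ η * M := by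
  have hq : 0 < 1 - p := by linarith
  have hα0 : 0 ≤ α := by
    by_contra! hneg
    nlinarith
  have hα1 : 1 / 2 ≤ 1 - α := by
    by_contra! hlt
    nlinarith
  have hM : t.choose r * p ^ r * p ^ t * (1 - p) ^ (r + (d + 1)) * (1 - α) ≤ M := by
    refine le_of_mul_le_mul_left (le_trans (le_of_eq ?_) h) (pow_pos h0 r)
    ring
  have hch : (1 / 2 : ℝ) ^ r ≤ t.choose r * p ^ r := by
    refine le_trans ?_ (pow_div_factorial_le_choose_mul_pow h0.le (m := t - r) (by omega))
    have h2 := one_le_pow_div_factorial hr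
    calc (1 / 2 : ℝ) ^ r ≤ (1 / 2) ^ r * ((p * t) ^ r / r !) :=
          le_mul_of_one_le_right (by positivity) h2
      _ = (p * (t / 2)) ^ r / r ! := by
          rw [mul_div_assoc', ← mul_pow]; ring_nf
      _ ≤ _ := by
          have : (t : ℝ) / 2 ≤ ((t - r : ℕ) : ℝ) := by
            rw [Nat.cast_sub (by omega)]
            have : (2 * r : ℝ) ≤ t := by exact_mod_cast ht
            linarith
          gcongr
  have hαd : α ^ d ≤ 4 * p * (1 - p) ^ d := by
    have hle : α ≤ 4 * p * (1 - p) := by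
      by_contra! hlt
      nlinarith
    calc α ^ d ≤ (4 * p * (1 - p)) ^ d := by gcongr
      _ = (4 * p) ^ d * (1 - p) ^ d := mul_pow _ _ _
      _ ≤ _ := by
          gcongr
          exact pow_le_of_le_one (by linarith) (by linarith) (by omega)
  have hαt := odds_pow_le h0 h1 hα hpt
  calc α ^ (t + d) = α ^ t * α ^ d := pow_add _ _ _
    _ ≤ (p ^ t * Real.exp (2 * c)) * (4 * p * (1 - p) ^ d) := by gcongr
    -- The 2r + 2 halves bound the binomial term (r), (1 - p)^(r+1) (r + 1) and 1 - α (one).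
    _ = Real.exp (2 * c) * (4 * p) * 2 ^ (2 * r + 2) *
        ((1 / 2) ^ (2 * r + 2) * (p ^ t * (1 - p) ^ d)) := by
        rw [one_div, inv_pow]; field_simp
    _ ≤ η * ((1 / 2) ^ (2 * r + 2) * (p ^ t * (1 - p) ^ d)) := by gcongr
    _ = η * ((1 / 2) ^ r * p ^ t * ((1 / 2) ^ (r + 1) * (1 - p) ^ d) * (1 / 2)) := by ring
    _ ≤ η * (t.choose r * p ^ r * p ^ t * ((1 - p) ^ (r + 1) * (1 - p) ^ d) * (1 - α)) := by
        gcongr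
        linarith
    _ = η * (t.choose r * p ^ r * p ^ t * (1 - p) ^ (r + (d + 1)) * (1 - α)) := by ring
    _ ≤ η * M := by gcongr

end Estimates

/-! ### Assembling the stability theorem. -/

section Main

open scoped Nat
open Filter Topology

theorem odds_properties {p : ℝ} (h0 : 0 < p) (h1 : p ≤ 1 / 10) :
    p / (1 - p) * (1 - p) = p ∧ p / (1 - p) ≤ 2 * p ∧ 0 ≤ p / (1 - p) := by
  have hq : 0 < 1 - p := by linarith
  refine ⟨div_mul_cancel₀ _ hq.ne', ?_, by positivity⟩
  rw [div_le_iff₀ hq]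
  nlinarith

/-- The loss is expressed through a bound P ≥ p, later (r+1)/t, so that the threshold on t does not
depend on p. -/
theorem pow_mul_le_productMeasure_franklFamily {n t r : ℕ} {p P : ℝ} (hn : t + 2 * r ≤ n)
    (h0 : 0 < p) (hpP : p ≤ P) (hP : P ≤ 1 / 10) :
    p ^ t * ((p * t) ^ r / r !) * ((1 - P) ^ r * (1 - 2 * P)) ≤
      productMeasure p (franklFamily n t r) := by
  obtain ⟨hα, hα2, hα0⟩ := odds_properties h0 (hpP.trans hP)
  refine le_trans ?_ (le_productMeasure_franklFamily hn h0 (by linarith) hα (by linarith))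
  have h2 := pow_div_factorial_le_choose_mul_pow h0.le (m := t) (T := t + 2 * r) (i := r)
    (by omega)
  have h3 : 1 - 2 * P ≤ 1 - p / (1 - p) := by linarith
  calc _ ≤ p ^ t * ((t + 2 * r).choose r * p ^ r) * ((1 - p) ^ r * (1 - p / (1 - p))) := by
        have : 0 ≤ 1 - P := by linarith
        have : 0 ≤ 1 - 2 * P := by linarith
        have : 0 ≤ 1 - p := by linarith
        gcongr
    _ = _ := by ring

/-- For large `t`, both families of a nice pair of nearly optimal measure contain a set whose walk
peaks exactly at time `t + 2r`, at height `t`. -/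
theorem IsNice.exists_peaksOnlyAt_of_product_ge {n t r S : ℕ} {p ε δ₀ δ P : ℝ}
    {𝒜 ℬ : Finset (Finset (Fin n))} (h : IsNice t 𝒜 ℬ) (hε : 0 < ε) (hε' : ε < 1 / 2)
    (hδ : δ ≤ δ₀) (hδ₀ : δ₀ < 1) (hn : t + 2 * r ≤ n) (ht : 0 < t) (h0 : 0 < p) (hpP : p ≤ P)
    (hP : P ≤ 1 / 10) (hxl : r + ε ≤ p * t) (hxu : p * t ≤ r + 1 - ε)
    (hS : Real.exp (2 * (r + 1)) ^ 2 * (3 / 4) ^ S ≤ 1 - ε / (r + 1))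
    (hmain : (1 - ε / (r + 1)) * (1 + S / t) ^ S + 8 * P * Real.exp (2 * (r + 1)) ^ 2 <
      (1 - δ₀) * ((1 - P) ^ r * (1 - 2 * P)) ^ 2)
    (hprod : (1 - δ) * productMeasure p (franklFamily n t r) ^ 2 ≤
      productMeasure p 𝒜 * productMeasure p ℬ) :
    (∃ A ∈ 𝒜, PeaksOnlyAt A (t + 2 * r) t) ∧ ∃ B ∈ ℬ, PeaksOnlyAt B (t + 2 * r) t := by
  obtain ⟨hα, hα2, hα0⟩ := odds_properties h0 (hpP.trans hP)
  set α := p / (1 - p)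
  set y : ℝ := (p * t) ^ r / r ! with hy
  set K : ℝ := Real.exp (2 * (r + 1)) with hK
  set ρ : ℝ := 1 - ε / (r + 1) with hρ
  set Z : ℝ := ρ * (1 + S / t) ^ S + 8 * P * K ^ 2 with hZ
  have hr : (0 : ℝ) ≤ r := r.cast_nonneg
  have h1 : p < 1 := by linarith
  have hP0 : 0 < P := h0.trans_le hpP
  have hy1 : 1 ≤ y := one_le_pow_div_factorial (by linarith)
  have hy2 : 1 ≤ y ^ 2 := one_le_pow₀ hy1
  have hρ0 : 0 ≤ ρ := le_trans (by positivity) hS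
  have hpt : (0 : ℝ) < p ^ (2 * t) := by positivity
  have hz : (1 : ℝ) ≤ (1 + S / t) ^ S := one_le_pow₀ (by
    have : (0 : ℝ) ≤ S / t := by positivity
    linarith)
  have hF := pow_mul_le_productMeasure_franklFamily hn h0 hpP hP
  have hlow : p ^ (2 * t) * y ^ 2 * Z < productMeasure p 𝒜 * productMeasure p ℬ := by
    refine lt_of_lt_of_le ?_ hprod
    calc p ^ (2 * t) * y ^ 2 * Z
        < p ^ (2 * t) * y ^ 2 * ((1 - δ₀) * ((1 - P) ^ r * (1 - 2 * P)) ^ 2) :=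
          mul_lt_mul_of_pos_left hmain (by positivity)
      _ = (1 - δ₀) * (p ^ t * y * ((1 - P) ^ r * (1 - 2 * P))) ^ 2 := by ring
      _ ≤ _ := by
        have e1 : 0 ≤ (1 - P) ^ r * (1 - 2 * P) :=
          mul_nonneg (pow_nonneg (by linarith) _) (by linarith)
        have e2 : 0 ≤ 1 - δ := by linarith
        gcongr
  have hZ0 : 0 ≤ Z := by positivity
  have hpos : 0 < productMeasure p 𝒜 * productMeasure p ℬ := lt_of_le_of_lt (by positivity) hlow
  have hA : 𝒜.Nonempty := by
    rw [Finset.nonempty_iff_ne_empty]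
    rintro rfl
    simp [productMeasure] at hpos
  have hB : ℬ.Nonempty := by
    rw [Finset.nonempty_iff_ne_empty]
    rintro rfl
    simp [productMeasure] at hpos
  have hα2t : α ^ (2 * t) ≤ p ^ (2 * t) * K ^ 2 := by
    have := odds_pow_le (c := (r : ℝ) + 1) h0 (hpP.trans hP) hα (t := t) (by linarith)
    calc α ^ (2 * t) = (α ^ t) ^ 2 := by ring
      _ ≤ (p ^ t * K) ^ 2 := by gcongr
      _ = _ := by ring
  have hsmall : 8 * p * α ^ (2 * t) ≤ p ^ (2 * t) * y ^ 2 * (8 * P * K ^ 2) := by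
    calc 8 * p * α ^ (2 * t) ≤ 8 * P * (p ^ (2 * t) * K ^ 2) := by gcongr
      _ = p ^ (2 * t) * 1 * (8 * P * K ^ 2) := by ring
      _ ≤ _ := by gcongr
  -- Every alternative except i = j = r bounds the product in this form.
  have hcontra : ∀ x ≤ p ^ (2 * t) * y ^ 2 * (ρ * (1 + S / t) ^ S),
      ¬ productMeasure p 𝒜 * productMeasure p ℬ ≤ x + 8 * p * α ^ (2 * t) := by
    intro x hx hle
    have : p ^ (2 * t) * y ^ 2 * Z = p ^ (2 * t) * y ^ 2 * (ρ * (1 + S / t) ^ S) +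
        p ^ (2 * t) * y ^ 2 * (8 * P * K ^ 2) := by rw [hZ]; ring
    linarith
  have hx0 : 0 ≤ p ^ (2 * t) * y ^ 2 * (ρ * (1 + S / t) ^ S) := by positivity
  have hpα : 0 ≤ p * α ^ (2 * t) := by positivity
  rcases h.product_small_or_peak hA hB h0 h1 hα (by linarith) with hs | hs | ⟨i, j, h𝒜, hℬ, hs⟩
  · refine absurd (hs.trans ?_) (hcontra 0 hx0)
    rw [pow_succ]
    have := mul_le_mul_of_nonneg_left hα2 (pow_nonneg hα0 (2 * t))
    linarith
  · exact absurd (hs.trans (by linarith)) (hcontra 0 hx0)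
  by_cases hij : i = r ∧ j = r
  · rw [hij.1, hij.2] at h𝒜 hℬ
    rw [show t + r + r = t + 2 * r by omega, show ((t : ℤ) + r - r) = t by omega] at h𝒜 hℬ
    exact ⟨h𝒜, hℬ⟩
  refine absurd hs (hcontra _ ?_)
  -- Finitely many pairs are handled by the gap, uniformly in t; the rest by geometric decay.
  rcases le_total (i + j) S with hle | hle
  · exact choose_mul_choose_le_of_small hε hε' ht h0 rfl hxl hxu hij hle
  · calc _ ≤ p ^ (2 * t) * (K ^ 2 * (3 / 4) ^ (i + j)) :=
          choose_mul_choose_le_of_large h0 (hpP.trans hP) (by linarith)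
      _ ≤ p ^ (2 * t) * (K ^ 2 * (3 / 4) ^ S) := by
          gcongr ?_ * (?_ * ?_)
          exact pow_le_pow_of_le_one (by norm_num) (by norm_num) hle
      _ ≤ p ^ (2 * t) * ρ := by gcongr
      _ = p ^ (2 * t) * 1 * (ρ * 1) := by ring
      _ ≤ _ := by gcongr

theorem IsNice.productMeasure_sdiff_le {n t r : ℕ} {p η : ℝ} {𝒜 ℬ : Finset (Finset (Fin n))}
    (h : IsNice t 𝒜 ℬ) (hn : t + 2 * r ≤ n) (h0 : 0 < p) (h1 : p ≤ 1 / 10)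
    (hpt : p * t ≤ r + 1) (hr : (r : ℝ) ≤ p * t) (ht : 2 * r ≤ t) (hη0 : 0 ≤ η)
    (hη : Real.exp (2 * (r + 1)) * (4 * p) * 2 ^ (2 * r + 2) ≤ η)
    (hB : ∃ B ∈ ℬ, PeaksOnlyAt B (t + 2 * r) t) :
    productMeasure p (𝒜 \ franklFamily n t r) ≤
      η * productMeasure p (franklFamily n t r \ ℬ) := by
  obtain ⟨hα, hα2, hα0⟩ := odds_properties h0 h1
  rcases h.sdiff_franklFamily hn h0 (by linarith) hα (by linarith) hB with he | ⟨d, hd, h3, h4⟩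
  · rw [he]
    have := productMeasure_nonneg h0.le (by linarith) (franklFamily n t r \ ℬ)
    simpa [productMeasure] using mul_nonneg hη0 this
  · exact h3.trans (odds_pow_le_of_profile h0 h1 hα hpt hr ht hd hη hη0 h4)

/-- The asymptotic conditions on `t` used in the stability theorem. -/
theorem eventually_threshold (r S : ℕ) {ρ K δ₀ η : ℝ} (hρ : ρ < 1 - δ₀) (hη : 0 < η) :
    ∀ᶠ t : ℕ in atTop, 0 < t ∧ 2 * r ≤ t ∧ ((r : ℝ) + 1) / t ≤ 1 / 10 ∧
      K * (4 * (((r : ℝ) + 1) / t)) * 2 ^ (2 * r + 2) ≤ η ∧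
      ρ * (1 + S / t) ^ S + 8 * (((r : ℝ) + 1) / t) * K ^ 2 <
        (1 - δ₀) * ((1 - ((r : ℝ) + 1) / t) ^ r * (1 - 2 * (((r : ℝ) + 1) / t))) ^ 2 := by
  have hP : Tendsto (fun t : ℕ => ((r : ℝ) + 1) / t) atTop (𝓝 0) :=
    tendsto_const_div_atTop_nhds_zero_nat _
  have hS : Tendsto (fun t : ℕ => (S : ℝ) / t) atTop (𝓝 0) :=
    tendsto_const_div_atTop_nhds_zero_nat _
  have e1 : Tendsto (fun t : ℕ => K * (4 * (((r : ℝ) + 1) / t)) * 2 ^ (2 * r + 2)) atTop (𝓝 0) := by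
    simpa using ((hP.const_mul 4).const_mul K).mul_const ((2 : ℝ) ^ (2 * r + 2))
  have e2 : Tendsto (fun t : ℕ => ρ * (1 + (S : ℝ) / t) ^ S + 8 * (((r : ℝ) + 1) / t) * K ^ 2)
      atTop (𝓝 ρ) := by
    simpa using (((hS.const_add 1).pow S).const_mul ρ).add ((hP.const_mul 8).mul_const (K ^ 2))
  have e3 : Tendsto (fun t : ℕ => (1 - δ₀) *
      ((1 - ((r : ℝ) + 1) / t) ^ r * (1 - 2 * (((r : ℝ) + 1) / t))) ^ 2) atTop (𝓝 (1 - δ₀)) := by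
    simpa using ((((hP.const_sub 1).pow r).mul ((hP.const_mul 2).const_sub 1)).pow 2).const_mul
      (1 - δ₀)
  -- The last condition compares the limits ρ and 1 - δ₀, so it needs the strict inequality between
  -- them.
  filter_upwards [eventually_gt_atTop 0, eventually_ge_atTop (2 * r),
    hP.eventually_le_const (by norm_num : (0 : ℝ) < 1 / 10), e1.eventually_le_const hη,
    e2.eventually_lt e3 hρ] with t h1 h2 h3 h4 h5
  exact ⟨h1, h2, h3, h4, h5⟩

end Main

end CrossIntersecting
open CrossIntersecting

theorem theorem1p3 (r : ℕ) (ε C δ₀ : ℝ) (hε : 0 < ε) (hε' : ε < 1 / 2) (hC : 2 < C)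
    (hδ₀ : 0 < δ₀) (hδ₀' : δ₀ < ε / ((r : ℝ) + 1)) :
    ∃ t₀ : ℕ, ∀ n t : ℕ, t₀ ≤ t → t + 2 * r ≤ n →
      ∀ p : ℝ, ((r : ℝ) + ε) / (t : ℝ) ≤ p → p ≤ ((r : ℝ) + 1 - ε) / (t : ℝ) →
      ∀ 𝒜 ℬ : Finset (Finset (Fin n)), CrossIntersecting.IsNice t 𝒜 ℬ →
      ∀ δ : ℝ, 0 < δ → δ ≤ δ₀ →
        (1 - δ) * CrossIntersecting.productMeasure p (CrossIntersecting.franklFamily n t r) ^ 2 ≤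
          CrossIntersecting.productMeasure p 𝒜 * CrossIntersecting.productMeasure p ℬ →
        CrossIntersecting.productMeasure p (𝒜 ∆ CrossIntersecting.franklFamily n t r) +
            CrossIntersecting.productMeasure p (ℬ ∆ CrossIntersecting.franklFamily n t r) ≤
          C * (1 - Real.sqrt (1 - δ)) *
            CrossIntersecting.productMeasure p (CrossIntersecting.franklFamily n t r) := by
  have hr : (0 : ℝ) ≤ r := r.cast_nonneg
  have hgap : ε / ((r : ℝ) + 1) < 1 := by
    rw [div_lt_one (by positivity)]
    linarith
  obtain ⟨S, hS⟩ := exists_pow_lt_of_lt_one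
    (show 0 < (1 - ε / ((r : ℝ) + 1)) / Real.exp (2 * (r + 1)) ^ 2 from
      div_pos (by linarith) (by positivity)) (show (3 / 4 : ℝ) < 1 by norm_num)
  rw [lt_div_iff₀' (by positivity)] at hS
  -- C > 2 leaves a positive η, which the O(1/t) ratio eventually undercuts.
  have hη : 0 < (C - 2) / (C + 2) := div_pos (by linarith) (by linarith)
  obtain ⟨t₀, ht₀⟩ := Filter.eventually_atTop.1 (eventually_threshold r S
    (ρ := 1 - ε / ((r : ℝ) + 1)) (K := Real.exp (2 * (r + 1))) (δ₀ := δ₀) (by linarith) hη)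
  refine ⟨t₀, fun n t ht hn p hpl hpu 𝒜 ℬ hnice δ _ hδ hprod => ?_⟩
  obtain ⟨ht0, htr, hP, hηP, hmain⟩ := ht₀ t ht
  have ht' : (0 : ℝ) < t := by exact_mod_cast ht0
  have h0 : 0 < p := lt_of_lt_of_le (by positivity) hpl
  have hpP : p ≤ ((r : ℝ) + 1) / t := hpu.trans (by gcongr; linarith)
  rw [div_le_iff₀ ht'] at hpl
  rw [le_div_iff₀ ht'] at hpu
  have hp1 : p ≤ 1 / 10 := hpP.trans hP
  obtain ⟨hA, hB⟩ := hnice.exists_peaksOnlyAt_of_product_ge hε hε' hδ (by linarith) hn ht0 h0 hpP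
    hP hpl hpu hS.le hmain hprod
  have hηp : Real.exp (2 * (r + 1)) * (4 * p) * 2 ^ (2 * r + 2) ≤ (C - 2) / (C + 2) := by
    refine le_trans ?_ hηP
    gcongr
  have hab := hnice.productMeasure_sdiff_le hn h0 hp1 (by linarith) (by linarith) htr hη.le hηp hB
  have hba := hnice.symm.productMeasure_sdiff_le hn h0 hp1 (by linarith) (by linarith) htr hη.le
    hηp hA
  have eA := productMeasure_sdiff_add_inter (p := p) 𝒜 (franklFamily n t r)
  have eB := productMeasure_sdiff_add_inter (p := p) ℬ (franklFamily n t r)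
  have eA' := productMeasure_sdiff_add_inter (p := p) (franklFamily n t r) 𝒜
  have eB' := productMeasure_sdiff_add_inter (p := p) (franklFamily n t r) ℬ
  rw [Finset.inter_comm] at eA' eB'
  have fA : productMeasure p (franklFamily n t r) + productMeasure p (𝒜 \ franklFamily n t r) -
      productMeasure p (franklFamily n t r \ 𝒜) = productMeasure p 𝒜 := by linarith
  have fB : productMeasure p (franklFamily n t r) + productMeasure p (ℬ \ franklFamily n t r) -
      productMeasure p (franklFamily n t r \ ℬ) = productMeasure p ℬ := by linarith
  rw [productMeasure_symmDiff, productMeasure_symmDiff]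
  refine add_le_of_product_ge (by linarith) hC (div_mul_cancel₀ _ (by linarith)) hab hba ?_ ?_ ?_
  · rw [fA]; exact productMeasure_nonneg h0.le (by linarith) _
  · rw [fB]; exact productMeasure_nonneg h0.le (by linarith) _
  · rw [fA, fB]; exact hprod
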